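/- For $n\ge 1$ let $\mathbf e_j$ and $\mathbf f_j$, $j=1,\dots,n$, be the spikes and sines in $\mathbb C^n$, i.e. $\mathbf e_j(t)=1$ if $t=j$ and $0$ otherwise, and $\mathbf f_j(t)=n^{-1/2}e^{2\pi \mathrm i jt/n}$ for $t=1,\dots,n$. Let $\mathbf F$ be the $n\times n$ discrete Fourier transform matrix, whose rows are $\mathbf f_1^*,\dots,\mathbf f_n^*$. For an $n\times n$ complex matrix $A$ and $\Omega,T\subset\{1,\dots,n\}$, let $A_{\Omega T}$ be the restriction of $A$ to the rows in $\Omega$ and the columns in $T$, and let $\|\cdot\|$ be the spectral norm ($\ell_2\to\ell_2$ operator norm). Theorem. There are a universal constant $C>0$ and, for every $\varepsilon>0$, constants $c(\varepsilon)\ge e^{-C/\min\{\varepsilon,1\}}$ (so $c(\varepsilon)\ge e^{-C/\varepsilon}$ for $\varepsilon\le 1$) and $N(\varepsilon)$, both depending only on $\varepsilon$, such that the following holds for all $\varepsilon>0$, all integers $n\ge N(\varepsilon)$ and all integers $0\le k,m\le n$ with $k+m\le c(\varepsilon)\,n$. Let $T$ and $\Omega$ be independent random subsets of $\{1,\dots,n\}$,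 uniformly distributed over the subsets of cardinality $k$ and of cardinality $m$, respectively. Then: 1. $\mathbb P\{\|\mathbf F_{\Omega T}\|^2\ge 1/2\}\le\exp(-n^{1/2-\varepsilon})$. 2. With probability at least $1-\exp(-n^{1/2-\varepsilon})$, the collection consisting of the spikes $\mathbf e_j$, $j\in T$, and the sines $\mathbf f_j$, $j\in\Omega$, is strongly linearly independent: it is linearly independent, and the condition number of its Gram matrix (the ratio of the largest to the smallest eigenvalue) is less than $3+2\sqrt2$. 3. For every complex $n\times n$ matrix $A=(a_{\omega t})$ with $\|A\|\le1$ and $|a_{\omega t}|\le n^{-1/2}$ for all $\omega,t$, $\mathbb P\{\|A_{\Omega T}\|^2\ge1/2\}\le\exp(-n^{1/2-\varepsilon})$. -/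

import Mathlib

open MeasureTheory ProbabilityTheory
open scoped Matrix Matrix.Norms.L2Operator

namespace SpikesSines

/-- The spike `e_j` of `ℂⁿ`. The element `j : Fin n` stands for the index `j + 1` in `{1, …, n}`. -/
noncomputable def spike (n : ℕ) (j : Fin n) : EuclideanSpace ℂ (Fin n) :=
  WithLp.toLp 2 fun t => if t = j then 1 else 0

/-- The sine `f_j(t) = n^{-1/2} e^{2πi j t / n}`, where `j` and `t` run over `{1, …, n}`
(hence the shifts by one). -/
noncomputable def sine (n : ℕ) (j : Fin n) : EuclideanSpace ℂ (Fin n) :=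
  WithLp.toLp 2 fun t =>
    1 / (Real.sqrt n : ℂ) *
      Complex.exp (2 * Real.pi * Complex.I * ((j : ℕ) + 1) * ((t : ℕ) + 1) / n)

/-- The `n × n` discrete Fourier transform matrix: its `j`-th row is `f_j^*`. -/
noncomputable def dft (n : ℕ) : Matrix (Fin n) (Fin n) ℂ :=
  Matrix.of fun j t => star (sine n j t)

/-- The restriction `A_{ΩT}` of `A` to the rows listed in `W` (that is, `Ω`) and the columns listed
in `T`. -/
def restrict {n : ℕ} (A : Matrix (Fin n) (Fin n) ℂ) (W T : Finset (Fin n)) : Matrix W T ℂ :=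
  A.submatrix (fun i : W => (i : Fin n)) (fun j : T => (j : Fin n))

/-- The law of a pair `(T, Ω)` of independent random sets, `T` uniformly distributed over the
`k`-element subsets and `Ω` uniformly distributed over the `m`-element subsets of an `n`-element
set. -/
noncomputable def randomPair (n k m : ℕ) : Measure (Finset (Fin n) × Finset (Fin n)) :=
  (uniformOn {S : Finset (Fin n) | S.card = k}).prod (uniformOn {S : Finset (Fin n) | S.card = m})

/-- The collection of the sines `f_j` (`j ∈ W`) and the spikes `e_j` (`j ∈ T`), as a family. -/
noncomputable def collection {n : ℕ} (T W : Finset (Fin n)) : W ⊕ T → EuclideanSpace ℂ (Fin n) :=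
  Sum.elim (fun j => sine n j) (fun j => spike n j)

/-- The condition number of the Gram matrix of a finite family of vectors: the largest eigenvalue
divided by the smallest one. -/
noncomputable def gramCond {ι E : Type*} [Fintype ι] [DecidableEq ι] [NormedAddCommGroup E]
    [InnerProductSpace ℂ E] (v : ι → E) : ℝ :=
  (⨆ i, (Matrix.isHermitian_gram ℂ v).eigenvalues i) /
    (⨅ i, (Matrix.isHermitian_gram ℂ v).eigenvalues i)

end SpikesSines

open SpikesSines

/-! The proof bounds the moment `E tr (BBᴴ)^q`, where `B` is the random restriction of `A`, without
combinatorics of closed walks. When indices are selected independently with probabilities `s * p i`,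
this moment is a polynomial in `s` of degree at most `4q` (`traceMoment_cut_mem_degreeLE`,
`exists_polynomial_of_mem_degreeLE`). On all of `[0, 1]` it is at most `n`, because `‖B‖ ≤ 1`. On
`[0, q/n]` it is at most `(C q²/n)^q`, because only about `q` rows and columns survive and the
Frobenius norm is tiny.

A polynomial of degree `d` bounded at the nodes `i/d` has coefficients exponential in `d` times that
bound (`norm_coeff_le_of_equispaced`). The bound on `[0, 1]` controls the coefficients of order at
least `k₀`, the bound on `[0, q/n]` those of lower order, and together they bound the moment at a
density `δ` independent of `n` (`norm_eval_le_of_two_scales`). With `q` about `n^(1/2-e)`, `k₀`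
about `e q` and `δ = exp (-64 / min ε 1)`, both contributions are `exp (-16 q)` up to polynomial
factors, and Markov's inequality gives the tail bound (`exists_moment_order`).

Sets of fixed size cost a factor `(n+1)^2` compared with independent selection
(`randomPair_real_le`). The claim on spikes and sines follows since the Gram matrix has diagonal
blocks `1` and off-diagonal blocks `R` and `Rᴴ`, where `R` is the restricted Fourier matrix, so its
eigenvalues are within `‖R‖` of `1`. -/

namespace SpikesSines

/-! ### Coefficients of a polynomial bounded at equispaced nodes -/

open Polynomial in
/-- The coefficients of a product of linear factors with roots in the unit disc. -/
theorem norm_coeff_prod_X_sub_C_le {ι : Type*} (s : Finset ι) (a : ι → ℂ)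
    (ha : ∀ i ∈ s, ‖a i‖ ≤ 1) (k : ℕ) : ‖(∏ i ∈ s, (X - C (a i))).coeff k‖ ≤ 2 ^ s.card := by
  classical
  induction s using Finset.induction_on generalizing k with
  | empty =>
    simp only [Finset.prod_empty, Finset.card_empty, pow_zero, coeff_one]
    split_ifs <;> simp
  | insert i s hi ih =>
    have ih' := ih fun j hj => ha j (Finset.mem_insert_of_mem hj)
    rw [Finset.prod_insert hi, Finset.card_insert_of_notMem hi, sub_mul, coeff_sub, coeff_C_mul,
      pow_succ, mul_two]
    refine (norm_sub_le _ _).trans (add_le_add ?_ ?_)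
    · cases k with
      | zero => simp
      | succ k => rw [coeff_X_mul]; exact ih' k
    · rw [norm_mul]
      exact (mul_le_of_le_one_left (norm_nonneg _) (ha i (Finset.mem_insert_self _ _))).trans (ih' k)

/-- These are, up to scaling by `d`, the denominators of the Lagrange basis at the nodes `i / d`;
divided into `d!` they produce binomial coefficients. -/
theorem prod_range_erase_abs_sub (d i : ℕ) (hi : i ≤ d) :
    ∏ j ∈ (Finset.range (d + 1)).erase i, |(i : ℝ) - j| = (i.factorial : ℝ) * (d - i).factorial := by
  have h : (Finset.range (d + 1)).erase i = Finset.range i ∪ Finset.Ico (i + 1) (d + 1) := by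
    ext j; simp only [Finset.mem_erase, Finset.mem_range, Finset.mem_union, Finset.mem_Ico]; omega
  rw [h, Finset.prod_union]
  · congr 1
    · rw [← Finset.prod_range_reflect, ← Finset.prod_range_add_one_eq_factorial]
      push_cast
      refine Finset.prod_congr rfl fun j hj => ?_
      have hj' := Finset.mem_range.1 hj
      rw [Nat.sub_sub, Nat.cast_sub (by omega), abs_of_nonneg] <;> push_cast <;> linarith
    · rw [Finset.prod_Ico_eq_prod_range, ← Finset.prod_range_add_one_eq_factorial]
      push_cast
      refine Finset.prod_congr rfl fun j _ => ?_
      have : (0 : ℝ) ≤ j := by positivity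
      rw [abs_of_nonpos] <;> linarith
  · rw [Finset.disjoint_left]; intro j; simp only [Finset.mem_range, Finset.mem_Ico]; omega

open Polynomial in
/-- A polynomial of degree at most `d`, bounded at the equispaced nodes `i / d` of `[0, 1]`,
has coefficients of size at most exponential in `d`. -/
theorem norm_coeff_le_of_equispaced (p : ℂ[X]) (d : ℕ) (hd : 0 < d) (hp : p.natDegree ≤ d) (M : ℝ)
    (hM : ∀ i ≤ d, ‖p.eval ((i : ℂ) / d)‖ ≤ M) (k : ℕ) :
    ‖p.coeff k‖ ≤ (4 * Real.exp 1) ^ d * M := by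
  have hd' : (0 : ℝ) < d := by exact_mod_cast hd
  have hdc : (d : ℂ) ≠ 0 := by exact_mod_cast hd.ne'
  have hinj : Set.InjOn (fun i : ℕ => (i : ℂ) / d) (Finset.range (d + 1) : Finset ℕ) := by
    intro i _ j _ h
    simpa [div_left_inj' hdc] using h
  have hdeg : p.degree < (Finset.range (d + 1)).card := by
    rw [Finset.card_range]
    exact lt_of_le_of_lt (degree_le_of_natDegree_le hp) (by exact_mod_cast Nat.lt_succ_self d)
  rw [Lagrange.eq_interpolate hinj hdeg, Lagrange.interpolate_apply, finsetSum_coeff]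
  -- The numerator of a basis polynomial has coefficients at most `2^d`, and its denominator
  -- contributes `d.choose i * d^d / d!`, where `d^d / d! ≤ e^d`. Summing the binomial coefficients
  -- gives a further `2^d`, hence `(4e)^d`.
  have hterm : ∀ i ∈ Finset.range (d + 1),
      ‖(C (p.eval ((i : ℂ) / d)) *
        Lagrange.basis (Finset.range (d + 1)) (fun i : ℕ => (i : ℂ) / d) i).coeff k‖
        ≤ (d.choose i : ℝ) * ((2 * Real.exp 1) ^ d * M) := by
    intro i hi
    have hid : i ≤ d := Nat.lt_succ_iff.1 (Finset.mem_range.1 hi)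
    have hM0 : 0 ≤ M := (norm_nonneg _).trans (hM i hid)
    have hcard : ((Finset.range (d + 1)).erase i).card = d := by
      rw [Finset.card_erase_of_mem hi, Finset.card_range]; rfl
    have hcoef := norm_coeff_prod_X_sub_C_le ((Finset.range (d + 1)).erase i)
      (fun j : ℕ => (j : ℂ) / d) (by
        intro j hj
        have := Finset.mem_range.1 (Finset.mem_of_mem_erase hj)
        rw [norm_div, Complex.norm_natCast, Complex.norm_natCast, div_le_one hd']
        exact_mod_cast Nat.lt_succ_iff.1 this) k
    rw [hcard] at hcoef
    have hprod : ‖∏ j ∈ (Finset.range (d + 1)).erase i, ((i : ℂ) / d - (j : ℂ) / d)⁻¹‖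
        = d.choose i * ((d : ℝ) ^ d / d.factorial) := by
      have h1 : ∀ j : ℕ, ‖((i : ℂ) / d - (j : ℂ) / d)⁻¹‖ = (d : ℝ) * |(i : ℝ) - j|⁻¹ := by
        intro j
        rw [← sub_div, norm_inv, norm_div, Complex.norm_natCast, inv_div]
        have : ((i : ℂ) - j) = ((i - j : ℝ) : ℂ) := by push_cast; rfl
        rw [this, Complex.norm_real, Real.norm_eq_abs]; rfl
      rw [norm_prod, Finset.prod_congr rfl fun j _ => h1 j, Finset.prod_mul_distrib,
        Finset.prod_const, hcard, Finset.prod_inv_distrib, prod_range_erase_abs_sub d i hid,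
        Nat.cast_choose ℝ hid]
      have a1 : (i.factorial : ℝ) ≠ 0 := by positivity
      have a2 : ((d - i).factorial : ℝ) ≠ 0 := by positivity
      have a3 : (d.factorial : ℝ) ≠ 0 := by positivity
      field_simp
    rw [coeff_C_mul, Lagrange.basis]
    simp only [Lagrange.basisDivisor]
    rw [Finset.prod_mul_distrib, ← map_prod, coeff_C_mul, norm_mul, norm_mul, hprod]
    have he := Real.pow_div_factorial_le_exp (d : ℝ) hd'.le d
    calc _ ≤ M * (d.choose i * Real.exp d * 2 ^ d) := by
          gcongr
          exact hM i hid
      _ = _ := by rw [mul_pow, ← Real.exp_nat_mul, mul_one]; ring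
  calc _ ≤ ∑ i ∈ Finset.range (d + 1), (d.choose i : ℝ) * ((2 * Real.exp 1) ^ d * M) :=
        norm_sum_le_of_le _ hterm
    _ = _ := by
        rw [← Finset.sum_mul, ← Nat.cast_sum, Nat.sum_range_choose]
        push_cast
        rw [← mul_assoc, ← mul_pow]; ring_nf

/-! ### Functions of low degree on finite sets -/

section DegreeLE

variable {α : Type*} [DecidableEq α]

/-- Functions of a finite set `S` that are combinations of the indicators of `U ⊆ S`, where `U` has
at most `d` elements. -/
def degreeLE (α : Type*) [DecidableEq α] (d : ℕ) : Submodule ℂ (Finset α → ℂ) :=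
  Submodule.span ℂ {g | ∃ U : Finset α, U.card ≤ d ∧ g = fun S => if U ⊆ S then 1 else 0}

theorem indicator_mem_degreeLE {d : ℕ} (U : Finset α) (hU : U.card ≤ d) :
    (fun S => if U ⊆ S then 1 else 0) ∈ degreeLE α d := Submodule.subset_span ⟨U, hU, rfl⟩

theorem const_mem_degreeLE (c : ℂ) (d : ℕ) : (fun _ => c) ∈ degreeLE α d := by
  have := (degreeLE α d).smul_mem c (indicator_mem_degreeLE ∅ (by simp))
  convert this using 1
  ext; simp

/-- The conditions `U ⊆ S` and `V ⊆ S` together say `U ∪ V ⊆ S`, so degrees add. -/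
theorem mul_mem_degreeLE {d e : ℕ} {f g : Finset α → ℂ} (hf : f ∈ degreeLE α d)
    (hg : g ∈ degreeLE α e) : f * g ∈ degreeLE α (d + e) := by
  refine Submodule.span_induction₂ (p := fun f g _ _ => f * g ∈ degreeLE α (d + e))
    ?_ ?_ ?_ ?_ ?_ ?_ ?_ hf hg
  · rintro _ _ ⟨U, hU, rfl⟩ ⟨V, hV, rfl⟩
    have := indicator_mem_degreeLE (d := d + e) (U ∪ V)
      ((Finset.card_union_le _ _).trans (add_le_add hU hV))
    convert this using 1
    ext S
    by_cases h1 : U ⊆ S <;> by_cases h2 : V ⊆ S <;> simp [h1, h2, Finset.union_subset_iff]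
  · intro y _; simp
  · intro x _; simp
  · intro x y z _ _ _ hx hy; rw [add_mul]; exact add_mem hx hy
  · intro x y z _ _ _ hx hy; rw [mul_add]; exact add_mem hx hy
  · intro r x y _ _ h; rw [smul_mul_assoc]; exact Submodule.smul_mem _ _ h
  · intro r x y _ _ h; rw [mul_smul_comm]; exact Submodule.smul_mem _ _ h

end DegreeLE

/-! ### Independent selection of indices -/

section Bernoulli

variable {α : Type*} [Fintype α] [DecidableEq α]

/-- The probability of `S` when each `i` is selected independently with probability `x i`. -/
def bernoulliWeight (x : α → ℝ) (S : Finset α) : ℝ := ∏ i, if i ∈ S then x i else 1 - x i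

theorem bernoulliWeight_eq (x : α → ℝ) (S : Finset α) :
    bernoulliWeight x S = (∏ i ∈ S, x i) * ∏ i ∈ Finset.univ \ S, (1 - x i) := by
  rw [bernoulliWeight, Finset.prod_ite]
  congr 1 <;> refine Finset.prod_congr ?_ fun _ _ => rfl <;> ext <;> simp

theorem bernoulliWeight_nonneg {x : α → ℝ} (h0 : ∀ i, 0 ≤ x i) (h1 : ∀ i, x i ≤ 1)
    (S : Finset α) : 0 ≤ bernoulliWeight x S := by
  refine Finset.prod_nonneg fun i _ => ?_
  split_ifs
  exacts [h0 i, sub_nonneg.2 (h1 i)]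

/-- Expanding the product of sums on the right gives one term for each `S`. Total mass, inclusion
probabilities and the exponential moment of the cardinality are all special cases. -/
theorem sum_bernoulliWeight_mul_prod (x : α → ℝ) (y z : α → ℝ) :
    ∑ S, bernoulliWeight x S * ((∏ i ∈ S, y i) * ∏ i ∈ Finset.univ \ S, z i)
      = ∏ i, (x i * y i + (1 - x i) * z i) := by
  rw [Finset.prod_add, Finset.powerset_univ]
  refine Finset.sum_congr rfl fun S _ => ?_
  rw [bernoulliWeight_eq, Finset.prod_mul_distrib, Finset.prod_mul_distrib]; ring

theorem sum_bernoulliWeight (x : α → ℝ) : ∑ S, bernoulliWeight x S = 1 := by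
  simpa using sum_bernoulliWeight_mul_prod x 1 1

/-- The choice `y = 1`, with `z` vanishing on `U` and equal to `1` elsewhere, turns the product over
the complement of `S` into the indicator of `U ⊆ S`. -/
theorem sum_bernoulliWeight_mul_indicator (x : α → ℝ) (U : Finset α) :
    ∑ S, bernoulliWeight x S * (if U ⊆ S then 1 else 0) = ∏ i ∈ U, x i := by
  have h := sum_bernoulliWeight_mul_prod x 1 (fun i => if i ∈ U then 0 else 1)
  have h2 : ∏ i, (x i * (1 : α → ℝ) i + (1 - x i) * (if i ∈ U then 0 else 1)) = ∏ i ∈ U, x i := by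
    rw [← Finset.prod_subset (Finset.subset_univ U)]
    · exact Finset.prod_congr rfl fun i hi => by simp [hi]
    · intro i _ hi; simp [hi]
  rw [← h2, ← h]
  refine Finset.sum_congr rfl fun S _ => ?_
  congr 1
  split_ifs with hU
  · have : ∏ i ∈ Finset.univ \ S, (if i ∈ U then (0 : ℝ) else 1) = 1 :=
      Finset.prod_eq_one fun i hi => if_neg fun hi' => (Finset.mem_sdiff.1 hi).2 (hU hi')
    simp [this]
  · obtain ⟨i, hi, hiS⟩ := Finset.not_subset.1 hU
    rw [Finset.prod_eq_zero (i := i) (s := Finset.univ \ S) (by simp [hiS]) (by simp [hi]), mul_zero]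

/-- Each index contributes a factor `1 + (e - 1) x i ≤ 1 + 2 x i ≤ exp (2 x i)`. -/
theorem sum_bernoulliWeight_mul_exp_card_le {x : α → ℝ} (h0 : ∀ i, 0 ≤ x i) :
    ∑ S, bernoulliWeight x S * Real.exp S.card ≤ Real.exp (2 * ∑ i, x i) := by
  have h := sum_bernoulliWeight_mul_prod x (fun _ => Real.exp 1) 1
  simp only [Finset.prod_const, Pi.one_apply, one_pow, mul_one, ← Real.exp_nat_mul] at h
  rw [h, Finset.mul_sum, Real.exp_sum]
  have he : Real.exp 1 ≤ 3 := by have := Real.exp_one_lt_d9; linarith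
  have he' : (1 : ℝ) ≤ Real.exp 1 := Real.one_le_exp (by norm_num)
  refine Finset.prod_le_prod (fun i _ => ?_) fun i _ => ?_
  · nlinarith [h0 i]
  · have := Real.add_one_le_exp (2 * x i)
    nlinarith [h0 i]

open Polynomial in
/-- The expectation of a function of degree at most `d` is polynomial in the density. -/
theorem exists_polynomial_of_mem_degreeLE {d : ℕ} {g : Finset α → ℂ} (hg : g ∈ degreeLE α d)
    (x : α → ℝ) : ∃ P : ℂ[X], P.natDegree ≤ d ∧
      ∀ s : ℝ, P.eval (s : ℂ) = ∑ S, (bernoulliWeight (fun i => s * x i) S : ℂ) * g S := by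
  refine Submodule.span_induction (p := fun g _ => ∃ P : ℂ[X], P.natDegree ≤ d ∧
      ∀ s : ℝ, P.eval (s : ℂ) = ∑ S, (bernoulliWeight (fun i => s * x i) S : ℂ) * g S)
    ?_ ?_ ?_ ?_ hg
  · rintro _ ⟨U, hU, rfl⟩
    refine ⟨C (∏ i ∈ U, (x i : ℂ)) * X ^ U.card, (natDegree_C_mul_X_pow_le _ _).trans hU,
      fun s => ?_⟩
    have h := congrArg (fun r : ℝ => (r : ℂ)) (sum_bernoulliWeight_mul_indicator (fun i => s * x i) U)
    simp only [Complex.ofReal_sum, Complex.ofReal_mul, Complex.ofReal_prod, apply_ite Complex.ofReal,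
      Complex.ofReal_one, Complex.ofReal_zero] at h
    rw [h, Finset.prod_mul_distrib, Finset.prod_const]
    rw [eval_mul, eval_C, eval_pow, eval_X, mul_comm]
  · exact ⟨0, by simp, by simp⟩
  · rintro f g _ _ ⟨P, hP, hP'⟩ ⟨Q, hQ, hQ'⟩
    refine ⟨P + Q, natDegree_add_le_of_degree_le hP hQ, fun s => ?_⟩
    simp [hP', hQ', mul_add, Finset.sum_add_distrib]
  · rintro a f _ ⟨P, hP, hP'⟩
    refine ⟨C a * P, (natDegree_C_mul_le _ _).trans hP, fun s => ?_⟩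
    simp only [eval_mul, eval_C, hP', Finset.mul_sum, Pi.smul_apply, smul_eq_mul]
    exact Finset.sum_congr rfl fun _ _ => by ring

end Bernoulli

/-! ### Trace moments and the spectral norm -/

section Trace

variable {ι : Type*} [Fintype ι] [DecidableEq ι]

theorem norm_unitary_conj (U : unitary (Matrix ι ι ℂ)) (X : Matrix ι ι ℂ) :
    ‖Unitary.conjStarAlgAut ℂ (Matrix ι ι ℂ) U X‖ = ‖X‖ := by
  rw [Unitary.conjStarAlgAut_apply, ← Unitary.coe_star, CStarRing.norm_mul_coe_unitary,
    CStarRing.norm_coe_unitary_mul]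

theorem trace_unitary_conj (U : unitary (Matrix ι ι ℂ)) (X : Matrix ι ι ℂ) :
    (Unitary.conjStarAlgAut ℂ (Matrix ι ι ℂ) U X).trace = X.trace := by
  rw [Unitary.conjStarAlgAut_apply, Matrix.trace_mul_cycle]
  simp

theorem trace_pow_eq_sum_eigenvalues {H : Matrix ι ι ℂ} (hH : H.IsHermitian) (q : ℕ) :
    (H ^ q).trace = ((∑ i, hH.eigenvalues i ^ q : ℝ) : ℂ) := by
  conv_lhs => rw [hH.spectral_theorem, ← map_pow, trace_unitary_conj, Matrix.diagonal_pow]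
  simp [Matrix.trace]

theorem norm_eq_norm_eigenvalues {H : Matrix ι ι ℂ} (hH : H.IsHermitian) :
    ‖H‖ = ‖hH.eigenvalues‖ := by
  conv_lhs => rw [hH.spectral_theorem, norm_unitary_conj, Matrix.l2_opNorm_diagonal]
  simp [Pi.norm_def]

variable (B : Matrix ι ι ℂ) (q : ℕ)

/-- The real number `tr (B B^*)^q`. -/
noncomputable def traceMoment : ℝ := (((B * Bᴴ) ^ q).trace).re

theorem traceMoment_eq : traceMoment B q =
    ∑ i, (Matrix.isHermitian_mul_conjTranspose_self B).eigenvalues i ^ q := by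
  rw [traceMoment, trace_pow_eq_sum_eigenvalues (Matrix.isHermitian_mul_conjTranspose_self B),
    Complex.ofReal_re]

theorem ofReal_traceMoment : (traceMoment B q : ℂ) = ((B * Bᴴ) ^ q).trace := by
  rw [traceMoment_eq, trace_pow_eq_sum_eigenvalues (Matrix.isHermitian_mul_conjTranspose_self B)]

open scoped ComplexOrder in
theorem eigenvalues_mul_conjTranspose_nonneg (i : ι) :
    0 ≤ (Matrix.isHermitian_mul_conjTranspose_self B).eigenvalues i :=
  (Matrix.posSemidef_self_mul_conjTranspose B).eigenvalues_nonneg i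

theorem norm_eigenvalues_mul_conjTranspose :
    ‖(Matrix.isHermitian_mul_conjTranspose_self B).eigenvalues‖ = ‖B‖ ^ 2 := by
  rw [← norm_eq_norm_eigenvalues]
  have := Matrix.l2_opNorm_conjTranspose_mul_self Bᴴ
  rw [Matrix.conjTranspose_conjTranspose, Matrix.l2_opNorm_conjTranspose] at this
  rw [this, sq]

theorem traceMoment_nonneg : 0 ≤ traceMoment B q := by
  rw [traceMoment_eq]
  exact Finset.sum_nonneg fun i _ => pow_nonneg (eigenvalues_mul_conjTranspose_nonneg B i) _

theorem norm_pow_le_traceMoment (hq : q ≠ 0) : (‖B‖ ^ 2) ^ q ≤ traceMoment B q := by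
  have h0 := eigenvalues_mul_conjTranspose_nonneg B
  rw [traceMoment_eq, ← norm_eigenvalues_mul_conjTranspose]
  set l := (Matrix.isHermitian_mul_conjTranspose_self B).eigenvalues
  rcases isEmpty_or_nonempty ι with h | h
  · simp [Pi.norm_def, hq]
  · obtain ⟨i, hi⟩ := Finite.exists_max l
    have hl : ‖l‖ ≤ l i := (pi_norm_le_iff_of_nonneg (h0 i)).2 fun j => by
      rw [Real.norm_of_nonneg (h0 j)]; exact hi j
    refine (pow_le_pow_left₀ (norm_nonneg _) hl q).trans ?_
    exact Finset.single_le_sum (f := fun i => l i ^ q) (fun i _ => pow_nonneg (h0 i) _)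
      (Finset.mem_univ i)

theorem traceMoment_le_card (hB : ‖B‖ ≤ 1) : traceMoment B q ≤ Fintype.card ι := by
  have h0 := eigenvalues_mul_conjTranspose_nonneg B
  have h1 := norm_eigenvalues_mul_conjTranspose B
  rw [traceMoment_eq]
  set l := (Matrix.isHermitian_mul_conjTranspose_self B).eigenvalues
  have : ∀ i, l i ^ q ≤ 1 := fun i => pow_le_one₀ (h0 i) <|
    (le_abs_self _).trans <| (norm_le_pi_norm l i).trans <|
      h1.le.trans (pow_le_one₀ (norm_nonneg _) hB)
  simpa using Finset.sum_le_card_nsmul Finset.univ (fun i => l i ^ q) 1 fun i _ => this i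

theorem traceMoment_one : traceMoment B 1 = ∑ i, ∑ j, ‖B i j‖ ^ 2 := by
  simp only [traceMoment, pow_one, Matrix.trace, Matrix.diag, Matrix.mul_apply,
    Matrix.conjTranspose_apply, Complex.re_sum]
  refine Finset.sum_congr rfl fun i _ => Finset.sum_congr rfl fun j _ => ?_
  rw [← Complex.normSq_eq_norm_sq, ← Complex.ofReal_re (Complex.normSq (B i j)),
    Complex.normSq_eq_conj_mul_self, mul_comm]; rfl

/-- For nonnegative eigenvalues `∑ λ^q ≤ (∑ λ)^q`, and `∑ λ` is the squared Frobenius norm. -/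
theorem traceMoment_le_frobenius (hq : q ≠ 0) :
    traceMoment B q ≤ (∑ i, ∑ j, ‖B i j‖ ^ 2) ^ q := by
  have h0 := eigenvalues_mul_conjTranspose_nonneg B
  rw [← traceMoment_one, traceMoment_eq, traceMoment_eq]
  set l := (Matrix.isHermitian_mul_conjTranspose_self B).eigenvalues
  simp only [pow_one]
  obtain ⟨q, rfl⟩ := Nat.exists_eq_succ_of_ne_zero hq
  have hle : ∀ i, l i ≤ ∑ i, l i := fun i =>
    Finset.single_le_sum (f := l) (fun i _ => h0 i) (Finset.mem_univ i)
  rw [Nat.succ_eq_add_one, pow_succ, Finset.mul_sum]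
  refine Finset.sum_le_sum fun i _ => ?_
  rw [pow_succ]
  exact mul_le_mul_of_nonneg_right (pow_le_pow_left₀ (h0 i) (hle i) _) (h0 i)

end Trace

/-! ### Extrapolation from two scales -/

open Polynomial in
/-- Extrapolation: a polynomial which is bounded on `[0, 1]` and very small on `[0, ρ]` is small
at `δ`. -/
theorem norm_eval_le_of_two_scales (P : ℂ[X]) (d k₀ : ℕ) (hd : 0 < d) (hP : P.natDegree ≤ d)
    {ρ δ M₁ M₂ : ℝ} (hρ : 0 < ρ) (hρ1 : ρ ≤ 1) (hδ : 0 ≤ δ) (hδ1 : δ ≤ 1)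
    (h₁ : ∀ s : ℝ, 0 ≤ s → s ≤ 1 → ‖P.eval (s : ℂ)‖ ≤ M₁)
    (h₂ : ∀ s : ℝ, 0 ≤ s → s ≤ ρ → ‖P.eval (s : ℂ)‖ ≤ M₂) :
    ‖P.eval (δ : ℂ)‖ ≤ (d + 1) * ((4 * Real.exp 1) ^ d * (M₁ * δ ^ k₀ + M₂ * (ρ⁻¹) ^ k₀)) := by
  have hd' : (0 : ℝ) < d := by exact_mod_cast hd
  have hM₁ : 0 ≤ M₁ := (norm_nonneg _).trans (h₁ 0 le_rfl zero_le_one)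
  have hM₂ : 0 ≤ M₂ := (norm_nonneg _).trans (h₂ 0 le_rfl hρ.le)
  have hnode : ∀ i ≤ d, (0 : ℝ) ≤ i / d ∧ (i : ℝ) / d ≤ 1 := fun i hi =>
    ⟨by positivity, (div_le_one hd').2 (by exact_mod_cast hi)⟩
  have c₁ : ∀ k, ‖P.coeff k‖ ≤ (4 * Real.exp 1) ^ d * M₁ := fun k =>
    norm_coeff_le_of_equispaced P d hd hP M₁ (fun i hi => by
      simpa using h₁ _ (hnode i hi).1 (hnode i hi).2) k
  -- The coefficient bound is applied to `P(ρX)`, whose nodes lie in `[0, ρ]`.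
  have c₂ : ∀ k, ‖P.coeff k‖ * ρ ^ k ≤ (4 * Real.exp 1) ^ d * M₂ := fun k => by
    have := norm_coeff_le_of_equispaced (P.comp (C (ρ : ℂ) * X)) d hd
      (natDegree_comp_le.trans
        ((Nat.mul_le_mul hP ((natDegree_C_mul_le _ _).trans natDegree_X_le)).trans (mul_one d).le))
      M₂ (fun i hi => by
      have := h₂ (ρ * (i / d)) (mul_nonneg hρ.le (hnode i hi).1)
        (mul_le_of_le_one_right hρ.le (hnode i hi).2)
      simpa using this) k
    rwa [comp_C_mul_X_coeff, norm_mul, norm_pow, Complex.norm_real, Real.norm_of_nonneg hρ.le] at this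
  rw [eval_eq_sum_range' (Nat.lt_succ_of_le hP)]
  have hK : 0 ≤ (4 * Real.exp 1) ^ d := by positivity
  have hρi : 1 ≤ ρ⁻¹ := (one_le_inv₀ hρ).2 hρ1
  refine (norm_sum_le_of_le _ (f := fun k => P.coeff k * (δ : ℂ) ^ k) (n := fun _ =>
    (4 * Real.exp 1) ^ d * (M₁ * δ ^ k₀ + M₂ * (ρ⁻¹) ^ k₀)) fun k _ => ?_).trans ?_
  · rw [norm_mul, norm_pow, Complex.norm_real, Real.norm_of_nonneg hδ]
    have hA : 0 ≤ M₁ * δ ^ k₀ := by positivity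
    have hB : 0 ≤ M₂ * (ρ⁻¹) ^ k₀ := by positivity
    -- High orders gain `δ^k₀` from the bound on `[0, 1]`; low orders lose at most `ρ^(-k₀)` from
    -- the bound on `[0, ρ]`.
    rcases le_total k₀ k with h | h
    · calc _ ≤ ((4 * Real.exp 1) ^ d * M₁) * δ ^ k₀ :=
            mul_le_mul (c₁ k) (pow_le_pow_of_le_one hδ hδ1 h) (by positivity) (by positivity)
        _ ≤ _ := by rw [mul_assoc]; exact mul_le_mul_of_nonneg_left (by linarith) hK
    · have hk : ‖P.coeff k‖ ≤ (4 * Real.exp 1) ^ d * M₂ * (ρ⁻¹) ^ k := by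
        rw [inv_pow, ← div_eq_mul_inv, le_div_iff₀ (by positivity)]; exact c₂ k
      calc _ ≤ ‖P.coeff k‖ := mul_le_of_le_one_right (norm_nonneg _) (pow_le_one₀ hδ hδ1)
        _ ≤ (4 * Real.exp 1) ^ d * M₂ * (ρ⁻¹) ^ k₀ :=
            hk.trans (mul_le_mul_of_nonneg_left (pow_le_pow_right₀ hρi h) (by positivity))
        _ ≤ _ := by rw [mul_assoc]; exact mul_le_mul_of_nonneg_left (by linarith) hK
  · simp

/-! ### Moments of random restrictions (`Sum.inl` marks columns, `Sum.inr` rows) -/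

section Cut

variable {n : ℕ}

/-- The matrix `A` with the rows outside of `Ω` and the columns outside of `T` replaced by zero,
where `S` is the disjoint union of `T` and `Ω`. -/
def cut (A : Matrix (Fin n) (Fin n) ℂ) (S : Finset (Fin n ⊕ Fin n)) : Matrix (Fin n) (Fin n) ℂ :=
  Matrix.of fun i j => if {Sum.inr i, Sum.inl j} ⊆ S then A i j else 0

theorem cut_eq (A : Matrix (Fin n) (Fin n) ℂ) (S : Finset (Fin n ⊕ Fin n)) :
    cut A S = Matrix.diagonal (fun i => if Sum.inr i ∈ S then 1 else 0) * A *
      Matrix.diagonal (fun j => if Sum.inl j ∈ S then 1 else 0) := by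
  ext i j
  rw [Matrix.mul_diagonal, Matrix.diagonal_mul, cut, Matrix.of_apply]
  simp only [Finset.insert_subset_iff, Finset.singleton_subset_iff]
  by_cases h1 : Sum.inr i ∈ S <;> by_cases h2 : Sum.inl j ∈ S <;> simp [h1, h2]

theorem norm_cut_le (A : Matrix (Fin n) (Fin n) ℂ) (S : Finset (Fin n ⊕ Fin n)) :
    ‖cut A S‖ ≤ ‖A‖ := by
  have h : ∀ p : Fin n → Prop, ∀ [DecidablePred p],
      ‖(Matrix.diagonal (fun i => if p i then 1 else 0) : Matrix (Fin n) (Fin n) ℂ)‖ ≤ 1 := by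
    intro p _
    rw [Matrix.l2_opNorm_diagonal, pi_norm_le_iff_of_nonneg zero_le_one]
    intro i
    split_ifs <;> simp
  rw [cut_eq]
  calc _ ≤ ‖Matrix.diagonal (fun i => if Sum.inr i ∈ S then (1 : ℂ) else 0)‖ * ‖A‖ *
        ‖Matrix.diagonal (fun i => if Sum.inl i ∈ S then (1 : ℂ) else 0)‖ :=
        (norm_mul_le _ _).trans (mul_le_mul_of_nonneg_right (norm_mul_le _ _) (norm_nonneg _))
    _ ≤ 1 * ‖A‖ * 1 := by
        gcongr
        · exact h _
        · exact h _
    _ = ‖A‖ := by ring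

/-- Passing to a submatrix does not increase the norm. -/
theorem norm_restrict_le (M : Matrix (Fin n) (Fin n) ℂ) (W T : Finset (Fin n)) :
    ‖restrict M W T‖ ≤ ‖M‖ := by
  rw [Matrix.l2_opNorm_def]
  refine ContinuousLinearMap.opNorm_le_bound _ (norm_nonneg _) fun x => ?_
  set y : EuclideanSpace ℂ (Fin n) := WithLp.toLp 2 fun j => if h : j ∈ T then x ⟨j, h⟩ else 0
    with hy
  have hxy : ‖y‖ = ‖x‖ := by
    rw [EuclideanSpace.norm_eq, EuclideanSpace.norm_eq]
    congr 1
    rw [← Finset.sum_subset (Finset.subset_univ T), ← Finset.sum_coe_sort T]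
    · exact Finset.sum_congr rfl fun j _ => by simp [hy]
    · intro j _ hj; simp [hy, hj]
  have hval : ∀ i : W, (restrict M W T).mulVec x.ofLp i = M.mulVec y.ofLp i := by
    intro i
    simp only [Matrix.mulVec, dotProduct, restrict, Matrix.submatrix_apply]
    rw [← Finset.sum_subset (Finset.subset_univ T), ← Finset.sum_coe_sort T]
    · exact Finset.sum_congr rfl fun j _ => by simp [hy]
    · intro j _ hj; simp [hy, hj]
  have hM := Matrix.l2_opNorm_mulVec M y
  rw [hxy] at hM
  refine le_trans ?_ hM
  rw [EuclideanSpace.norm_eq, EuclideanSpace.norm_eq]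
  refine Real.sqrt_le_sqrt ?_
  calc _ = ∑ i : W, ‖M.mulVec y.ofLp i‖ ^ 2 :=
        Finset.sum_congr rfl fun i _ => by rw [← hval]; rfl
    _ = ∑ i ∈ W, ‖M.mulVec y.ofLp i‖ ^ 2 := Finset.sum_coe_sort W fun i => ‖M.mulVec y.ofLp i‖ ^ 2
    _ ≤ _ := Finset.sum_le_sum_of_subset_of_nonneg (Finset.subset_univ _) fun j _ _ => by positivity

theorem norm_restrict_le_norm_cut (A : Matrix (Fin n) (Fin n) ℂ) (S : Finset (Fin n ⊕ Fin n)) :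
    ‖restrict A S.toRight S.toLeft‖ ≤ ‖cut A S‖ := by
  convert norm_restrict_le (cut A S) S.toRight S.toLeft using 2
  ext i j
  have hi := Finset.mem_toRight.1 i.2
  have hj := Finset.mem_toLeft.1 j.2
  simp [restrict, cut, Finset.insert_subset_iff, hi, hj]

/-- An entry of `cut A S` depends on the selection of one row and one column, hence has degree 2.
Each of the `q` factors `BBᴴ` multiplies two entries and adds 4 to the degree. -/
theorem traceMoment_cut_mem_degreeLE (A : Matrix (Fin n) (Fin n) ℂ) (q : ℕ) :
    (fun S => (traceMoment (cut A S) q : ℂ)) ∈ degreeLE (Fin n ⊕ Fin n) (4 * q) := by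
  have hentry : ∀ i j (z : ℂ), (fun S : Finset (Fin n ⊕ Fin n) =>
      if {Sum.inr i, Sum.inl j} ⊆ S then z else 0) ∈ degreeLE (Fin n ⊕ Fin n) 2 := by
    intro i j z
    have := (degreeLE (Fin n ⊕ Fin n) 2).smul_mem z
      (indicator_mem_degreeLE {Sum.inr i, Sum.inl j} Finset.card_le_two)
    convert this using 1
    ext S; simp
  have hH : ∀ i k, (fun S => (cut A S * (cut A S)ᴴ) i k) ∈ degreeLE (Fin n ⊕ Fin n) 4 := by
    intro i k
    have : (fun S => (cut A S * (cut A S)ᴴ) i k) = ∑ j, (fun S : Finset (Fin n ⊕ Fin n) =>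
        if {Sum.inr i, Sum.inl j} ⊆ S then A i j else 0) * (fun S : Finset (Fin n ⊕ Fin n) =>
        if {Sum.inr k, Sum.inl j} ⊆ S then star (A k j) else 0) := by
      ext S
      rw [Matrix.mul_apply, Finset.sum_apply]
      refine Finset.sum_congr rfl fun j _ => ?_
      simp only [cut, Matrix.conjTranspose_apply, Matrix.of_apply, Pi.mul_apply, apply_ite star,
        star_zero]
    rw [this]
    exact sum_mem fun j _ => mul_mem_degreeLE (d := 2) (e := 2) (hentry i j _) (hentry k j _)
  have hpow : ∀ q i k, (fun S => ((cut A S * (cut A S)ᴴ) ^ q) i k)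
      ∈ degreeLE (Fin n ⊕ Fin n) (4 * q) := by
    intro q
    induction q with
    | zero => intro i k; simpa using const_mem_degreeLE ((1 : Matrix (Fin n) (Fin n) ℂ) i k) 0
    | succ q ih =>
      intro i k
      have : (fun S => ((cut A S * (cut A S)ᴴ) ^ (q + 1)) i k) =
          ∑ j, (fun S => ((cut A S * (cut A S)ᴴ) ^ q) i j) *
            (fun S => (cut A S * (cut A S)ᴴ) j k) := by
        ext S
        rw [pow_succ, Matrix.mul_apply, Finset.sum_apply]; rfl
      rw [this, mul_add, mul_one]
      exact sum_mem fun j _ => mul_mem_degreeLE (ih i j) (hH j k)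
  have : (fun S => (traceMoment (cut A S) q : ℂ)) =
      ∑ i, fun S => ((cut A S * (cut A S)ᴴ) ^ q) i i := by
    ext S
    rw [ofReal_traceMoment, Finset.sum_apply]; rfl
  rw [this]
  exact sum_mem fun i _ => hpow q i i

/-- At most `|S|²` entries survive, each of squared size at most `1/n`. The estimate `|S|^(2q) ≤
(2q)! exp |S|` replaces the power by an exponential, whose expectation factorizes. -/
theorem traceMoment_cut_le {A : Matrix (Fin n) (Fin n) ℂ} (hA : ∀ i j, ‖A i j‖ ^ 2 ≤ (n : ℝ)⁻¹)
    {q : ℕ} (hq : q ≠ 0) (S : Finset (Fin n ⊕ Fin n)) :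
    traceMoment (cut A S) q ≤ (2 * q) ^ (2 * q) * Real.exp S.card / n ^ q := by
  have hle : ∀ f : Fin n → Fin n ⊕ Fin n, Function.Injective f →
      ∑ i, (if f i ∈ S then (1 : ℝ) else 0) ≤ S.card := by
    intro f hf
    rw [Finset.sum_boole]
    exact_mod_cast Finset.card_le_card_of_injOn f (by intro i hi; simpa using hi) hf.injOn
  have hF : ∑ i, ∑ j, ‖cut A S i j‖ ^ 2 ≤ (S.card : ℝ) ^ 2 * (n : ℝ)⁻¹ := by
    calc _ ≤ ∑ i : Fin n, ∑ j : Fin n, (if Sum.inr i ∈ S then (1 : ℝ) else 0) *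
          (if Sum.inl j ∈ S then (1 : ℝ) else 0) * (n : ℝ)⁻¹ := by
          refine Finset.sum_le_sum fun i _ => Finset.sum_le_sum fun j _ => ?_
          by_cases h1 : Sum.inr i ∈ S <;> by_cases h2 : Sum.inl j ∈ S <;>
            simp [cut, Finset.insert_subset_iff, h1, h2, hA]
      _ = (∑ i : Fin n, if Sum.inr i ∈ S then (1 : ℝ) else 0) *
          (∑ j : Fin n, if Sum.inl j ∈ S then (1 : ℝ) else 0) * (n : ℝ)⁻¹ := by
          rw [Finset.sum_mul_sum, Finset.sum_mul]
          simp_rw [Finset.sum_mul]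
      _ ≤ _ := by
          rw [sq]
          gcongr
          · exact hle _ Sum.inr_injective
          · exact hle _ Sum.inl_injective
  have hS : (S.card : ℝ) ^ (2 * q) ≤ (2 * q) ^ (2 * q) * Real.exp S.card := by
    have h := Real.pow_div_factorial_le_exp (S.card : ℝ) (by positivity) (2 * q)
    rw [div_le_iff₀ (by positivity)] at h
    refine h.trans ?_
    rw [mul_comm]
    gcongr
    exact_mod_cast Nat.factorial_le_pow (2 * q)
  calc _ ≤ ((S.card : ℝ) ^ 2 * (n : ℝ)⁻¹) ^ q :=
        (traceMoment_le_frobenius _ q hq).trans (pow_le_pow_left₀ (by positivity) hF q)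
    _ = (S.card : ℝ) ^ (2 * q) / n ^ q := by rw [mul_pow, ← pow_mul, inv_pow]; rfl
    _ ≤ _ := by gcongr

/-- The moment bound for the restriction of `A` to random sets with densities `δ p_i`. -/
theorem sum_bernoulliWeight_mul_traceMoment_le {A : Matrix (Fin n) (Fin n) ℂ} (hA1 : ‖A‖ ≤ 1)
    (hA : ∀ i j, ‖A i j‖ ^ 2 ≤ (n : ℝ)⁻¹) {q : ℕ} (hq : 0 < q) (hqn : q ≤ n)
    {p : Fin n ⊕ Fin n → ℝ} (hp0 : ∀ i, 0 ≤ p i) (hp1 : ∀ i, p i ≤ 1) {δ : ℝ} (hδ : 0 ≤ δ)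
    (hδ1 : δ ≤ 1) (k₀ : ℕ) :
    ∑ S, bernoulliWeight (fun i => δ * p i) S * traceMoment (cut A S) q ≤
      (4 * q + 1) * ((4 * Real.exp 1) ^ (4 * q) *
        (n * δ ^ k₀ + (4 * Real.exp 4 * q ^ 2 / n) ^ q * (n / q : ℝ) ^ k₀)) := by
  have hn : (0 : ℝ) < n := by exact_mod_cast hq.trans_le hqn
  have hq' : (0 : ℝ) < q := by exact_mod_cast hq
  obtain ⟨P, hPd, hP⟩ := exists_polynomial_of_mem_degreeLE (traceMoment_cut_mem_degreeLE A q) p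
  have hP' : ∀ s : ℝ, P.eval (s : ℂ) =
      ((∑ S, bernoulliWeight (fun i => s * p i) S * traceMoment (cut A S) q : ℝ) : ℂ) := by
    intro s; rw [hP]; push_cast; rfl
  have hw : ∀ s : ℝ, 0 ≤ s → s ≤ 1 → ∀ S, 0 ≤ bernoulliWeight (fun i => s * p i) S :=
    fun s h0 h1 S => bernoulliWeight_nonneg (fun i => mul_nonneg h0 (hp0 i))
      (fun i => mul_le_one₀ h1 (hp0 i) (hp1 i)) S
  have hnorm : ∀ s : ℝ, 0 ≤ s → s ≤ 1 → ‖P.eval (s : ℂ)‖ =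
      ∑ S, bernoulliWeight (fun i => s * p i) S * traceMoment (cut A S) q := by
    intro s h0 h1
    rw [hP', Complex.norm_real, Real.norm_of_nonneg]
    exact Finset.sum_nonneg fun S _ => mul_nonneg (hw s h0 h1 S) (traceMoment_nonneg _ _)
  have hρ : (0 : ℝ) < q / n := by positivity
  have hρ1 : (q : ℝ) / n ≤ 1 := (div_le_one hn).2 (by exact_mod_cast hqn)
  have key := norm_eval_le_of_two_scales P (4 * q) k₀ (by omega) hPd (ρ := q / n) (δ := δ)
    (M₁ := n) (M₂ := (4 * Real.exp 4 * q ^ 2 / n) ^ q) hρ hρ1 hδ hδ1 ?_ ?_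
  · rw [hnorm δ hδ hδ1] at key
    rw [inv_div] at key
    push_cast at key
    exact key
  · intro s h0 h1
    rw [hnorm s h0 h1]
    calc _ ≤ ∑ S, bernoulliWeight (fun i => s * p i) S * n := by
          gcongr with S
          · exact hw s h0 h1 S
          · simpa using traceMoment_le_card (cut A S) q ((norm_cut_le A S).trans hA1)
      _ = n := by rw [← Finset.sum_mul, sum_bernoulliWeight, one_mul]
  · intro s h0 h1
    have h1' := h1.trans hρ1
    rw [hnorm s h0 h1']
    calc _ ≤ ∑ S, bernoulliWeight (fun i => s * p i) S *
          ((2 * q) ^ (2 * q) * Real.exp S.card / n ^ q) := by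
          gcongr with S
          · exact hw s h0 h1' S
          · exact traceMoment_cut_le hA hq.ne' S
      _ = (∑ S, bernoulliWeight (fun i => s * p i) S * Real.exp S.card) *
          ((2 * q) ^ (2 * q) / n ^ q) := by
          rw [Finset.sum_mul]
          exact Finset.sum_congr rfl fun S _ => by ring
      _ ≤ Real.exp (2 * ∑ i, s * p i) * ((2 * q) ^ (2 * q) / n ^ q) := by
          gcongr
          exact sum_bernoulliWeight_mul_exp_card_le fun i => mul_nonneg h0 (hp0 i)
      _ ≤ Real.exp (q * 4) * ((2 * q) ^ (2 * q) / n ^ q) := by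
          -- There are `2n` indices, each of density at most `q / n`, so the expected size of `S` is
          -- at most `2q`.
          refine mul_le_mul_of_nonneg_right (Real.exp_le_exp.2 ?_) (by positivity)
          have : ∑ i, s * p i ≤ ∑ i : Fin n ⊕ Fin n, (q : ℝ) / n :=
            Finset.sum_le_sum fun i _ => (mul_le_of_le_one_right h0 (hp1 i)).trans h1
          rw [Finset.sum_const, Finset.card_univ, Fintype.card_sum, Fintype.card_fin,
            nsmul_eq_mul] at this
          have h3 : ((n + n : ℕ) : ℝ) * (q / n) = 2 * q := by push_cast; field_simp; ring
          linarith
      _ = _ := by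
          rw [Real.exp_nat_mul, pow_mul, ← mul_div_assoc, ← mul_pow, ← div_pow]
          ring_nf

end Cut

/-! ### From independent selection to sets of fixed size -/

section Transfer

/-- This compares a binomial term `t` places away from the mode with the mode itself, in cleared
form. It rests on `m! m^t ≤ (m+t)!` and `(l+t)! ≤ l! (l+t)^t`. -/
theorem pow_mul_factorial_le (m l t : ℕ) :
    m ^ (m + t) * (l + t) ^ l * (m.factorial * (l + t).factorial) ≤
      m ^ m * (l + t) ^ (l + t) * ((m + t).factorial * l.factorial) := by
  have h1 : m.factorial * m ^ t ≤ (m + t).factorial := by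
    simpa using Nat.factorial_mul_pow_sub_le_factorial (Nat.le_add_right m t)
  have h2 : (l + t).factorial ≤ l.factorial * (l + t) ^ t := by
    have := Nat.factorial_mul_descFactorial (Nat.le_add_left t l)
    rw [Nat.add_sub_cancel] at this
    rw [← this]
    exact Nat.mul_le_mul_left _ (Nat.descFactorial_le_pow _ _)
  calc _ = m ^ m * (l + t) ^ l * ((m.factorial * m ^ t) * (l + t).factorial) := by ring
    _ ≤ m ^ m * (l + t) ^ l * ((m + t).factorial * (l.factorial * (l + t) ^ t)) :=
        Nat.mul_le_mul_left _ (Nat.mul_le_mul h1 h2)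
    _ = _ := by ring

/-- The mode of the binomial distribution with mean `m` is `m`. -/
theorem pow_mul_choose_le (m l j : ℕ) (hj : j ≤ m + l) :
    m ^ j * l ^ (m + l - j) * (m + l).choose j ≤ m ^ m * l ^ l * (m + l).choose m := by
  have key : m ^ j * l ^ (m + l - j) * (m.factorial * l.factorial) ≤
      m ^ m * l ^ l * (j.factorial * (m + l - j).factorial) := by
    rcases le_total m j with h | h
    · obtain ⟨t, rfl⟩ := Nat.exists_eq_add_of_le h
      obtain ⟨l', rfl⟩ := Nat.exists_eq_add_of_le' (show t ≤ l by omega)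
      rw [show m + (l' + t) - (m + t) = l' by omega]
      exact pow_mul_factorial_le m l' t
    -- Below the mode the same comparison applies after exchanging successes and failures.
    · obtain ⟨t, rfl⟩ := Nat.exists_eq_add_of_le h
      rw [show j + t + l - j = l + t by omega]
      have := pow_mul_factorial_le l j t
      linarith
  have c1 := Nat.choose_mul_factorial_mul_factorial hj
  have c2 := Nat.choose_mul_factorial_mul_factorial (Nat.le_add_right m l)
  rw [Nat.add_sub_cancel_left] at c2
  have hpos : 0 < (j.factorial * (m + l - j).factorial) * (m.factorial * l.factorial) := by positivity
  refine Nat.le_of_mul_le_mul_right ?_ hpos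
  calc _ = ((m + l).choose j * j.factorial * (m + l - j).factorial) *
        (m ^ j * l ^ (m + l - j) * (m.factorial * l.factorial)) := by ring
    _ ≤ ((m + l).choose m * m.factorial * l.factorial) *
        (m ^ m * l ^ l * (j.factorial * (m + l - j).factorial)) := by
        rw [c1, c2]; exact Nat.mul_le_mul_left _ key
    _ = _ := by ring

/-- The `n + 1` binomial probabilities sum to `1` and the one at the mode `m` is the largest, so it
is at least `1 / (n + 1)`. -/
theorem one_le_mul_choose {n m : ℕ} (hn : 0 < n) (hm : m ≤ n) :
    1 ≤ (n + 1) * (((m : ℝ) / n) ^ m * (1 - (m : ℝ) / n) ^ (n - m)) * n.choose m := by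
  obtain ⟨l, rfl⟩ := Nat.exists_eq_add_of_le hm
  have h : (m + l) ^ (m + l) ≤ (m + l + 1) * (m ^ m * l ^ l * (m + l).choose m) := by
    rw [add_pow]
    refine (Finset.sum_le_card_nsmul _ _ (m ^ m * l ^ l * (m + l).choose m) fun j hj => ?_).trans ?_
    · exact pow_mul_choose_le m l j (Nat.lt_succ_iff.1 (Finset.mem_range.1 hj))
    · simp
  have h' : ((m : ℝ) + l) ^ (m + l) ≤ (m + l + 1) * (m ^ m * l ^ l * (m + l).choose m) := by
    exact_mod_cast h
  have hpos : (0 : ℝ) < (m + l : ℝ) := by exact_mod_cast hn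
  rw [Nat.add_sub_cancel_left]
  push_cast
  have e : (1 - (m : ℝ) / (m + l)) = l / (m + l) := by field_simp; ring
  rw [e, div_pow, div_pow]
  have : (m + l + 1 : ℝ) * ((m : ℝ) ^ m / (m + l) ^ m * (l ^ l / (m + l) ^ l)) * (m + l).choose m
      = (m + l + 1) * (m ^ m * l ^ l * (m + l).choose m) / (m + l) ^ (m + l) := by
    rw [pow_add]; field_simp
  rw [this, le_div_iff₀ (by positivity), one_mul]
  exact h'

/-- The uniform law is independent selection conditioned on having size `m`, an event of probability
at least `1 / (n + 1)`. -/
theorem uniformOn_real_singleton_le {n m : ℕ} (hn : 0 < n) (hm : m ≤ n) (T : Finset (Fin n)) :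
    (uniformOn {S : Finset (Fin n) | S.card = m}).real {T} ≤
      (n + 1) * bernoulliWeight (fun _ => (m : ℝ) / n) T := by
  have hn' : (0 : ℝ) < n := by exact_mod_cast hn
  have h1 : (m : ℝ) / n ≤ 1 := (div_le_one hn').2 (by exact_mod_cast hm)
  have hset : {S : Finset (Fin n) | S.card = m} =
      ((Finset.univ : Finset (Fin n)).powersetCard m : Finset (Finset (Fin n))) := by
    ext S; simp
  rw [measureReal_def, hset, ← Finset.coe_singleton, uniformOn_apply_finset,
    ENNReal.toReal_div, ENNReal.toReal_natCast, ENNReal.toReal_natCast, Finset.card_powersetCard,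
    Finset.card_univ, Fintype.card_fin]
  by_cases hT : T.card = m
  · have : (Finset.univ.powersetCard m ∩ {T}) = {T} := by
      ext S; simp only [Finset.mem_inter, Finset.mem_powersetCard, Finset.mem_singleton]
      constructor
      · exact fun h => h.2
      · rintro rfl; exact ⟨⟨Finset.subset_univ _, hT⟩, rfl⟩
    have hc : (0 : ℝ) < n.choose m := by exact_mod_cast Nat.choose_pos hm
    rw [this, Finset.card_singleton, bernoulliWeight_eq, Finset.prod_const, Finset.prod_const, hT,
      ← Finset.compl_eq_univ_sdiff, Finset.card_compl, hT, Fintype.card_fin, Nat.cast_one,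
      div_le_iff₀ hc]
    exact one_le_mul_choose hn hm
  · have : (Finset.univ.powersetCard m ∩ {T}) = ∅ := by
      ext S; simp only [Finset.mem_inter, Finset.mem_powersetCard, Finset.mem_singleton,
        Finset.notMem_empty, iff_false]
      rintro ⟨⟨_, h⟩, rfl⟩; exact hT h
    rw [this]
    simp only [Finset.card_empty, Nat.cast_zero, zero_div]
    exact mul_nonneg (by positivity) (bernoulliWeight_nonneg (fun _ => by positivity) (fun _ => h1) T)

theorem bernoulliWeight_sumEquiv {n : ℕ} (a b : ℝ) (S : Finset (Fin n ⊕ Fin n)) :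
    bernoulliWeight (Sum.elim (fun _ => a) fun _ => b) S =
      bernoulliWeight (fun _ => a) S.toLeft * bernoulliWeight (fun _ => b) S.toRight := by
  simp [bernoulliWeight, Fintype.prod_sum_type]

instance {n k m : ℕ} : IsFiniteMeasure (randomPair n k m) := by
  unfold randomPair uniformOn; infer_instance

/-- Comparison of uniformly distributed sets of fixed sizes with independent selection. -/
theorem randomPair_real_le {n k m : ℕ} (hn : 0 < n) (hk : k ≤ n) (hm : m ≤ n)
    (E : Set (Finset (Fin n) × Finset (Fin n))) (g : Finset (Fin n ⊕ Fin n) → ℝ)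
    (hg0 : ∀ S, 0 ≤ g S) (hg : ∀ S, (S.toLeft, S.toRight) ∈ E → 1 ≤ g S) :
    (randomPair n k m).real E ≤ (n + 1) ^ 2 *
      ∑ S, bernoulliWeight (Sum.elim (fun _ => (k : ℝ) / n) fun _ => (m : ℝ) / n) S * g S := by
  classical
  have hn' : (0 : ℝ) < n := by exact_mod_cast hn
  have hw : ∀ S : Finset (Fin n ⊕ Fin n),
      0 ≤ bernoulliWeight (Sum.elim (fun _ => (k : ℝ) / n) fun _ => (m : ℝ) / n) S := by
    refine bernoulliWeight_nonneg ?_ ?_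
    · rintro (i | i) <;> simp <;> positivity
    · rintro (i | i) <;> simp <;> exact (div_le_one hn').2 (by exact_mod_cast ‹_›)
  have hE : (randomPair n k m).real E = ∑ p, if p ∈ E then (randomPair n k m).real {p} else 0 := by
    rw [← Finset.sum_filter, sum_measureReal_singleton]
    congr 1; ext; simp
  rw [hE, Finset.mul_sum, ← Equiv.sum_comp (Finset.sumEquiv (α := Fin n) (β := Fin n)).toEquiv
    (fun p => if p ∈ E then (randomPair n k m).real {p} else 0)]
  refine Finset.sum_le_sum fun S _ => ?_
  split_ifs with h
  · have hS : (randomPair n k m).real {(S.toLeft, S.toRight)} ≤ (n + 1) ^ 2 *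
        bernoulliWeight (Sum.elim (fun _ => (k : ℝ) / n) fun _ => (m : ℝ) / n) S := by
      rw [← Set.singleton_prod_singleton, randomPair, measureReal_prod_prod,
        bernoulliWeight_sumEquiv]
      calc _ ≤ _ := mul_le_mul (uniformOn_real_singleton_le hn hk _)
            (uniformOn_real_singleton_le hn hm _) measureReal_nonneg
            (measureReal_nonneg.trans (uniformOn_real_singleton_le hn hk _))
        _ = _ := by ring
    refine hS.trans ?_
    rw [← mul_assoc]
    exact le_mul_of_one_le_right (mul_nonneg (by positivity) (hw S)) (hg S h)
  · exact mul_nonneg (by positivity) (mul_nonneg (hw S) (hg0 S))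

end Transfer

/-! ### Unitarity of the discrete Fourier matrix -/

section Fourier

theorem norm_sine_apply (n : ℕ) (j t : Fin n) : ‖sine n j t‖ = 1 / Real.sqrt n := by
  have h : (2 * Real.pi * Complex.I * ((j : ℕ) + 1) * ((t : ℕ) + 1) / n : ℂ) =
      ((2 * Real.pi * ((j : ℕ) + 1) * ((t : ℕ) + 1) / n : ℝ) : ℂ) * Complex.I := by
    push_cast; ring
  rw [sine, PiLp.toLp_apply, h, norm_mul, Complex.norm_exp_ofReal_mul_I, mul_one, norm_div, norm_one,
    Complex.norm_real, Real.norm_of_nonneg (Real.sqrt_nonneg _)]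

theorem star_sine_mul_sine (n : ℕ) (j k t : Fin n) :
    star (sine n j t) * sine n k t = (1 / n : ℂ) *
      Complex.exp (2 * Real.pi * Complex.I * (((k : ℕ) : ℂ) - (j : ℕ)) / n) ^ ((t : ℕ) + 1) := by
  have hs : (1 / (Real.sqrt n : ℂ)) * (1 / (Real.sqrt n : ℂ)) = 1 / n := by
    rw [div_mul_div_comm, one_mul, ← Complex.ofReal_mul, Real.mul_self_sqrt (Nat.cast_nonneg _),
      Complex.ofReal_natCast]
  have h1 : star (sine n j t) = 1 / (Real.sqrt n : ℂ) *
      Complex.exp (-(2 * Real.pi * Complex.I * ((j : ℕ) + 1) * ((t : ℕ) + 1) / n)) := by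
    rw [sine, PiLp.toLp_apply, Complex.star_def, map_mul, ← Complex.exp_conj]
    simp [Complex.conj_ofNat, neg_div]
  rw [h1, sine, PiLp.toLp_apply, mul_mul_mul_comm, hs, ← Complex.exp_add, ← Complex.exp_nat_mul]
  congr 2
  push_cast
  ring

/-- For `j ≠ k` this is a geometric sum over powers of an `n`-th root of unity `z`, and `z ≠ 1`
because `0 < |k - j| < n`. -/
theorem sum_star_sine_mul_sine (n : ℕ) (j k : Fin n) :
    ∑ t, star (sine n j t) * sine n k t = if j = k then 1 else 0 := by
  have hn : (n : ℂ) ≠ 0 := by exact_mod_cast (Fin.pos j).ne'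
  simp_rw [star_sine_mul_sine]
  rw [← Finset.mul_sum]
  split_ifs with h
  · subst h
    simp [hn]
  · set z := Complex.exp (2 * Real.pi * Complex.I * (((k : ℕ) : ℂ) - (j : ℕ)) / n) with hz
    have hzn : z ^ n = 1 := by
      rw [hz, ← Complex.exp_nat_mul, Complex.exp_eq_one_iff]
      refine ⟨(k : ℤ) - (j : ℤ), ?_⟩
      push_cast
      field_simp
    have hz1 : z ≠ 1 := by
      rw [hz, Ne, Complex.exp_eq_one_iff]
      rintro ⟨a, ha⟩
      have h2 : (2 * Real.pi * Complex.I : ℂ) ≠ 0 := Complex.two_pi_I_ne_zero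
      have h3 : (((k : ℕ) : ℂ) - (j : ℕ)) = a * n := by
        have : (2 * Real.pi * Complex.I : ℂ) * (((k : ℕ) : ℂ) - (j : ℕ)) =
            (2 * Real.pi * Complex.I : ℂ) * (a * n) := by
          rw [div_eq_iff hn] at ha
          rw [ha]; ring
        exact mul_left_cancel₀ h2 this
      have h4 : ((k : ℕ) : ℤ) - (j : ℕ) = a * n := by exact_mod_cast h3
      have hk := k.2
      have hj := j.2
      have ha0 : a ≠ 0 := by
        rintro rfl
        rw [zero_mul] at h4
        exact h (Fin.ext (by omega))
      have h5 : (n : ℤ) ≤ |a * n| := by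
        rw [abs_mul, Nat.abs_cast]
        have := Int.one_le_abs ha0
        nlinarith
      rw [← h4] at h5
      have : |((k : ℕ) : ℤ) - (j : ℕ)| < n := by rw [abs_lt]; constructor <;> omega
      omega
    simp_rw [pow_succ]
    rw [← Finset.sum_mul, ← Finset.sum_range (fun i => z ^ i), geom_sum_eq hz1, hzn]
    simp

theorem dft_mul_conjTranspose (n : ℕ) : dft n * (dft n)ᴴ = 1 := by
  ext j k
  rw [Matrix.mul_apply, Matrix.one_apply, ← sum_star_sine_mul_sine]
  simp [dft]

theorem norm_dft_le (n : ℕ) : ‖dft n‖ ≤ 1 := by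
  have h := Matrix.l2_opNorm_conjTranspose_mul_self (dft n)ᴴ
  rw [Matrix.conjTranspose_conjTranspose, Matrix.l2_opNorm_conjTranspose, dft_mul_conjTranspose,
    ← Matrix.diagonal_one, Matrix.l2_opNorm_diagonal] at h
  have h1 : ‖(fun _ => 1 : Fin n → ℂ)‖ ≤ 1 :=
    (pi_norm_le_iff_of_nonneg zero_le_one).2 fun _ => by simp
  rw [h] at h1
  nlinarith [norm_nonneg (dft n)]

theorem norm_dft_apply (n : ℕ) (i j : Fin n) : ‖dft n i j‖ = (n : ℝ) ^ (-(1 / 2 : ℝ)) := by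
  rw [dft, Matrix.of_apply, norm_star, norm_sine_apply, Real.sqrt_eq_rpow, one_div,
    Real.rpow_neg (Nat.cast_nonneg _)]

end Fourier

/-! ### Gram matrix of spikes and sines -/

section Gram

theorem sum_norm_sq_mulVec_le {ι κ : Type*} [Fintype ι] [Fintype κ] [DecidableEq κ]
    (M : Matrix ι κ ℂ) (x : κ → ℂ) :
    ∑ i, ‖M.mulVec x i‖ ^ 2 ≤ ‖M‖ ^ 2 * ∑ j, ‖x j‖ ^ 2 := by
  have h := Matrix.l2_opNorm_mulVec M (WithLp.toLp 2 x)
  have h2 := pow_le_pow_left₀ (norm_nonneg _) h 2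
  rw [mul_pow, EuclideanSpace.norm_sq_eq, EuclideanSpace.norm_sq_eq] at h2
  exact h2

theorem gram_collection {n : ℕ} (T W : Finset (Fin n)) :
    Matrix.gram ℂ (collection T W) =
      Matrix.fromBlocks 1 (restrict (dft n) W T) (restrict (dft n) W T)ᴴ 1 := by
  have hinner : ∀ x y : EuclideanSpace ℂ (Fin n), inner ℂ x y = ∑ t, star (x t) * y t := by
    intro x y
    rw [PiLp.inner_apply]
    exact Finset.sum_congr rfl fun t _ => by rw [RCLike.inner_apply, mul_comm]; rfl
  ext (i | i) (j | j)
  · rw [Matrix.gram_apply, hinner, Matrix.fromBlocks_apply₁₁, Matrix.one_apply]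
    simp only [collection, Sum.elim_inl]
    rw [sum_star_sine_mul_sine]
    simp only [Subtype.coe_inj]
  · rw [Matrix.gram_apply, hinner, Matrix.fromBlocks_apply₁₂]
    simp [collection, restrict, dft, spike]
  · rw [Matrix.gram_apply, hinner, Matrix.fromBlocks_apply₂₁]
    simp [collection, restrict, dft, spike]
  · rw [Matrix.gram_apply, hinner, Matrix.fromBlocks_apply₂₂, Matrix.one_apply]
    simp [collection, spike, eq_comm]

/-- A unit eigenvector `(a, b)` with eigenvalue `λ` satisfies `R b = (λ - 1) a` and `Rᴴ a = (λ - 1)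
b`. Adding the squared norms gives `(λ - 1)² ≤ ‖R‖²`. -/
theorem abs_eigenvalues_gram_collection_sub_one_le {n : ℕ} (T W : Finset (Fin n)) (i : W ⊕ T) :
    |(Matrix.isHermitian_gram ℂ (collection T W)).eigenvalues i - 1| ≤ ‖restrict (dft n) W T‖ := by
  set hG := Matrix.isHermitian_gram ℂ (collection T W)
  set R := restrict (dft n) W T
  set u : W ⊕ T → ℂ := (hG.eigenvectorBasis i).ofLp with hu
  have hnorm : (∑ a, ‖u (Sum.inl a)‖ ^ 2) + ∑ b, ‖u (Sum.inr b)‖ ^ 2 = 1 := by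
    have := hG.eigenvectorBasis.orthonormal.1 i
    rw [← Fintype.sum_sum_type (fun a => ‖u a‖ ^ 2), hu, ← EuclideanSpace.norm_sq_eq, this, one_pow]
  have heig : (Matrix.fromBlocks 1 R Rᴴ 1).mulVec u = (hG.eigenvalues i : ℝ) • u := by
    rw [← gram_collection]
    exact hG.mulVec_eigenvectorBasis i
  rw [Matrix.fromBlocks_mulVec] at heig
  have h1 : ∀ a, R.mulVec (u ∘ Sum.inr) a = ((hG.eigenvalues i - 1 : ℝ) : ℂ) * u (Sum.inl a) := by
    intro a
    have := congrFun heig (Sum.inl a)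
    simp only [Sum.elim_inl, Pi.add_apply, Matrix.one_mulVec, Function.comp_apply, Pi.smul_apply,
      Complex.real_smul] at this
    rw [Complex.ofReal_sub, sub_mul, ← this]; simp [R]
  have h2 : ∀ b, Rᴴ.mulVec (u ∘ Sum.inl) b = ((hG.eigenvalues i - 1 : ℝ) : ℂ) * u (Sum.inr b) := by
    intro b
    have := congrFun heig (Sum.inr b)
    simp only [Sum.elim_inr, Pi.add_apply, Matrix.one_mulVec, Function.comp_apply, Pi.smul_apply,
      Complex.real_smul] at this
    rw [Complex.ofReal_sub, sub_mul, ← this]; simp [R]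
  have b1 := sum_norm_sq_mulVec_le R (u ∘ Sum.inr)
  have b2 := sum_norm_sq_mulVec_le Rᴴ (u ∘ Sum.inl)
  simp only [h1, h2, norm_mul, mul_pow, ← Finset.mul_sum, Complex.norm_real, Real.norm_eq_abs,
    Matrix.l2_opNorm_conjTranspose, Function.comp_apply] at b1 b2
  refine abs_le_of_sq_le_sq' ?_ (norm_nonneg _) |> abs_le.2
  rw [← sq_abs]
  nlinarith

/-- The condition number is at most `(1 + r) / (1 - r)`, which increases with `r` and equals `3 +
2√2` at `r = 1/√2`. -/
theorem gramCond_lt {ι E : Type*} [Fintype ι] [DecidableEq ι] [NormedAddCommGroup E]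
    [InnerProductSpace ℂ E] (v : ι → E) {r : ℝ} (hr0 : 0 ≤ r) (hr : r ^ 2 < 1 / 2)
    (hv : ∀ i, |(Matrix.isHermitian_gram ℂ v).eigenvalues i - 1| ≤ r) :
    gramCond v < 3 + 2 * Real.sqrt 2 := by
  have hs : 0 ≤ Real.sqrt 2 := Real.sqrt_nonneg 2
  have hs2 : Real.sqrt 2 * Real.sqrt 2 = 2 := Real.mul_self_sqrt (by norm_num)
  have hr1 : r < 1 := by nlinarith
  have hrs : r * Real.sqrt 2 < 1 := by
    have : (r * Real.sqrt 2) ^ 2 < 1 := by nlinarith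
    exact lt_of_pow_lt_pow_left₀ 2 zero_le_one (by linarith)
  rw [gramCond]
  rcases isEmpty_or_nonempty ι with h | h
  -- For the empty family (`k = m = 0`) the supremum takes the default value `0`.
  · rw [Real.iSup_of_isEmpty, zero_div]; positivity
  · have h1 : (⨆ i, (Matrix.isHermitian_gram ℂ v).eigenvalues i) ≤ 1 + r :=
      ciSup_le fun i => by linarith [(abs_le.1 (hv i)).2]
    have h2 : 1 - r ≤ ⨅ i, (Matrix.isHermitian_gram ℂ v).eigenvalues i :=
      le_ciInf fun i => by linarith [(abs_le.1 (hv i)).1]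
    calc _ ≤ (1 + r) / (1 - r) := div_le_div₀ (by linarith) h1 (by linarith) h2
      _ < _ := by
        rw [div_lt_iff₀ (by linarith)]
        nlinarith

theorem strongly_linearIndependent_of_norm_lt {n : ℕ} {T W : Finset (Fin n)}
    (h : ‖restrict (dft n) W T‖ ^ 2 < 1 / 2) :
    LinearIndependent ℂ (collection T W) ∧ gramCond (collection T W) < 3 + 2 * Real.sqrt 2 := by
  have hv := abs_eigenvalues_gram_collection_sub_one_le T W
  refine ⟨?_, gramCond_lt _ (norm_nonneg _) h hv⟩
  refine Matrix.linearIndependent_of_posDef_gram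
    ((Matrix.isHermitian_gram ℂ _).posDef_iff_eigenvalues_pos.2 fun i => ?_)
  have hr1 : ‖restrict (dft n) W T‖ < 1 := by nlinarith [norm_nonneg (restrict (dft n) W T)]
  linarith [(abs_le.1 (hv i)).1]

end Gram

/-! ### Choice of parameters -/

section Asymptotics

/-- The choice of the order `q` of the moment and of the cut-off `k₀`. -/
theorem exists_moment_order (ε : ℝ) (hε : 0 < ε) : ∃ N : ℕ, ∀ n : ℕ, N ≤ n → ∃ q k₀ : ℕ,
    0 < q ∧ q ≤ n ∧ (n : ℝ) ^ (1 / 2 - ε) ≤ q ∧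
    (n + 1 : ℝ) ^ 2 * (2 ^ q * ((4 * q + 1) * ((4 * Real.exp 1) ^ (4 * q) *
      (n * Real.exp (-64 / min ε 1) ^ k₀ +
        (4 * Real.exp 4 * q ^ 2 / n) ^ q * (n / q : ℝ) ^ k₀)))) ≤ Real.exp (-(q : ℝ)) := by
  -- The cap at `1/4` keeps `q ≥ n^(1/4)`, so that `exp q` absorbs polynomial factors in `n`; the
  -- loss `min ε 1 ≤ 4 * e` accounts for `64 = 4 * 16`.
  set e := min ε (1 / 4) with he
  have he0 : 0 < e := lt_min hε (by norm_num)
  have he4 : e ≤ 1 / 4 := min_le_right _ _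
  have heε : e ≤ ε := min_le_left _ _
  have hmin : min ε 1 ≤ 4 * e := by
    rw [he, mul_min_of_nonneg _ _ (by norm_num)]
    exact min_le_min (by linarith) (by norm_num)
  have hmin0 : 0 < min ε 1 := lt_min hε one_pos
  obtain ⟨N, hN⟩ := exists_nat_ge (max (128 * (Nat.factorial 20 : ℝ))
    ((16 * Real.exp 20) ^ (1 / e)))
  refine ⟨N, fun n hn => ?_⟩
  have hNn : (N : ℝ) ≤ n := by exact_mod_cast hn
  have hn1 : 128 * (Nat.factorial 20 : ℝ) ≤ n := (le_max_left _ _).trans (hN.trans hNn)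
  have hn2 : (16 * Real.exp 20) ^ (1 / e) ≤ n := (le_max_right _ _).trans (hN.trans hNn)
  have hfac : (1 : ℝ) ≤ Nat.factorial 20 := by exact_mod_cast Nat.factorial_pos 20
  have hone : (1 : ℝ) ≤ n := by linarith
  have hpos : (0 : ℝ) < n := by linarith
  have hne : 16 * Real.exp 20 ≤ (n : ℝ) ^ e := by
    have := Real.rpow_le_rpow (by positivity) hn2 he0.le
    rwa [← Real.rpow_mul (by positivity), one_div_mul_cancel he0.ne', Real.rpow_one] at this
  set x := (n : ℝ) ^ (1 / 2 - e) with hx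
  have hx1 : 1 ≤ x := Real.one_le_rpow hone (by linarith)
  have hxn : x ≤ n := by
    have := Real.rpow_le_rpow_of_exponent_le hone (show 1 / 2 - e ≤ 1 by linarith)
    rwa [Real.rpow_one] at this
  set q := ⌈x⌉₊ with hq
  have hxq : x ≤ q := Nat.le_ceil x
  have hq2 : (q : ℝ) ≤ 2 * x := by linarith [Nat.ceil_lt_add_one (zero_le_one.trans hx1)]
  have hqn : q ≤ n := Nat.ceil_le.2 hxn
  have hqn' : (q : ℝ) ≤ n := by exact_mod_cast hqn
  have hq1 : (1 : ℝ) ≤ q := hx1.trans hxq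
  have hq0 : 0 < q := by exact_mod_cast zero_lt_one.trans_le hq1
  set k₀ := ⌈e * q⌉₊ with hk
  have hk1 : e * q ≤ k₀ := Nat.le_ceil _
  have hk2 : (k₀ : ℝ) ≤ e * q + 1 := (Nat.ceil_lt_add_one (by positivity)).le
  refine ⟨q, k₀, hq0, hqn, ?_, ?_⟩
  · exact (Real.rpow_le_rpow_of_exponent_le hone (by linarith)).trans hxq
  have hE : (0 : ℝ) < Real.exp (-16 * q) := Real.exp_pos _
  have hA : Real.exp (-64 / min ε 1) ^ k₀ ≤ Real.exp (-16 * q) := by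
    rw [← Real.exp_nat_mul, Real.exp_le_exp]
    have h1 : 16 / e ≤ 64 / min ε 1 := by
      rw [div_le_div_iff₀ he0 hmin0]; linarith
    have h2 : e * q * (16 / e) ≤ k₀ * (64 / min ε 1) :=
      mul_le_mul hk1 h1 (by positivity) (by positivity)
    have h3 : e * q * (16 / e) = 16 * q := by field_simp
    rw [neg_div]
    linarith
  -- Here `q²/n` is at most `4 n^(-2e)`. One factor `n^(-e)` pays for `n^k₀ ≤ n * n^(e q)`; the
  -- other beats `16 e^4` and leaves `e^(-16)`, by the threshold `16 e^20` for `n^e`.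
  have hB : (4 * Real.exp 4 * q ^ 2 / n) ^ q * (n / q : ℝ) ^ k₀ ≤ n * Real.exp (-16 * q) := by
    have h1 : 4 * Real.exp 4 * q ^ 2 / n ≤ 16 * Real.exp 4 * ((n : ℝ) ^ e)⁻¹ * ((n : ℝ) ^ e)⁻¹ := by
      have hxx : x ^ 2 = n * ((n : ℝ) ^ e)⁻¹ * ((n : ℝ) ^ e)⁻¹ := by
        rw [← Real.rpow_neg hpos.le, hx, sq, ← Real.rpow_add hpos]
        nth_rewrite 2 [← Real.rpow_one (n : ℝ)]
        rw [← Real.rpow_add hpos, ← Real.rpow_add hpos]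
        ring_nf
      have hqq : (q : ℝ) ^ 2 ≤ 4 * x ^ 2 := by nlinarith
      rw [div_le_iff₀ hpos]
      calc _ ≤ 4 * Real.exp 4 * (4 * x ^ 2) := by gcongr
        _ = _ := by rw [hxx]; ring
    have h2 : (n / q : ℝ) ^ k₀ ≤ n * ((n : ℝ) ^ e) ^ q := by
      calc (n / q : ℝ) ^ k₀ ≤ (n : ℝ) ^ k₀ := by
            gcongr
            exact div_le_self hpos.le hq1
        _ = (n : ℝ) ^ (k₀ : ℝ) := (Real.rpow_natCast _ _).symm
        _ ≤ (n : ℝ) ^ (e * q + 1) := Real.rpow_le_rpow_of_exponent_le hone hk2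
        _ = _ := by
            rw [Real.rpow_add hpos, Real.rpow_one, Real.rpow_mul hpos.le, Real.rpow_natCast,
              mul_comm]
    have h3 : 16 * Real.exp 4 * ((n : ℝ) ^ e)⁻¹ ≤ Real.exp (-16) := by
      rw [← div_eq_mul_inv, div_le_iff₀ (by positivity)]
      calc 16 * Real.exp 4 = Real.exp (-16) * (16 * Real.exp 20) := by
            rw [show (4 : ℝ) = -16 + 20 by norm_num, Real.exp_add]; ring
        _ ≤ _ := by gcongr
    have hne0 : (0 : ℝ) < (n : ℝ) ^ e := by positivity
    calc _ ≤ (16 * Real.exp 4 * ((n : ℝ) ^ e)⁻¹ * ((n : ℝ) ^ e)⁻¹) ^ q * (n * ((n : ℝ) ^ e) ^ q) := by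
          gcongr
      _ = n * (16 * Real.exp 4 * ((n : ℝ) ^ e)⁻¹) ^ q := by
          rw [mul_pow _ ((n : ℝ) ^ e)⁻¹, inv_pow]
          field_simp
      _ ≤ n * Real.exp (-16) ^ q := by gcongr
      _ = _ := by rw [← Real.exp_nat_mul, mul_comm (q : ℝ)]
  -- Since `q^20 ≥ n^5`, the term `q^20 / 20!` of the exponential series suffices once `n ≥ 128 *
  -- 20!`; here `128 = 8 * 2^4`.
  have hC : 8 * (n + 1 : ℝ) ^ 4 ≤ Real.exp q := by
    have h1 := Real.pow_div_factorial_le_exp (q : ℝ) (by positivity) 20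
    refine le_trans ?_ h1
    have h2 : (n : ℝ) ≤ (q : ℝ) ^ 4 := by
      have : (n : ℝ) ^ (1 / 4 : ℝ) ≤ q :=
        (Real.rpow_le_rpow_of_exponent_le hone (by linarith)).trans hxq
      have h := pow_le_pow_left₀ (by positivity) this 4
      rw [← Real.rpow_natCast, ← Real.rpow_mul hpos.le] at h
      norm_num at h
      exact h
    rw [le_div_iff₀ (by positivity)]
    calc _ ≤ 8 * (2 * n : ℝ) ^ 4 * (Nat.factorial 20 : ℝ) := by gcongr; linarith
      _ = (128 * (Nat.factorial 20 : ℝ)) * (n : ℝ) ^ 4 := by ring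
      _ ≤ n * (n : ℝ) ^ 4 := by gcongr
      _ = (n : ℝ) ^ 5 := by ring
      _ ≤ ((q : ℝ) ^ 4) ^ 5 := by gcongr
      _ = _ := by ring
  have hD : (2 : ℝ) ^ q * (4 * Real.exp 1) ^ (4 * q) ≤ Real.exp (13 * q) := by
    have h2 : (2 : ℝ) ≤ Real.exp 1 := by have := Real.add_one_le_exp (1 : ℝ); linarith
    have h3 : 4 * Real.exp 1 ≤ Real.exp 3 := by
      rw [show (3 : ℝ) = 1 + 1 + 1 by norm_num, Real.exp_add, Real.exp_add]
      gcongr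
      nlinarith
    calc _ ≤ Real.exp 1 ^ q * Real.exp 3 ^ (4 * q) := by gcongr
      _ = _ := by
        rw [← Real.exp_nat_mul, ← Real.exp_nat_mul, ← Real.exp_add]
        push_cast
        ring_nf
  calc _ ≤ (n + 1 : ℝ) ^ 2 * (2 ^ q * ((4 * (n + 1)) * ((4 * Real.exp 1) ^ (4 * q) *
        ((n + 1) * Real.exp (-16 * q) + (n + 1) * Real.exp (-16 * q))))) := by
        have h1 : n * Real.exp (-64 / min ε 1) ^ k₀ ≤ (n + 1) * Real.exp (-16 * q) := by
          gcongr; linarith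
        have h2 := hB.trans (mul_le_mul_of_nonneg_right (by linarith : (n : ℝ) ≤ n + 1) hE.le)
        have h3 := add_le_add h1 h2
        gcongr
        linarith
    _ = (8 * (n + 1 : ℝ) ^ 4) * ((2 : ℝ) ^ q * (4 * Real.exp 1) ^ (4 * q)) *
        Real.exp (-16 * q) := by ring
    _ ≤ Real.exp q * Real.exp (13 * q) * Real.exp (-16 * q) := by gcongr
    -- The exponents add up to `1 + 13 - 16 = -2`, below the required `-1`.
    _ ≤ _ := by
        rw [← Real.exp_add, ← Real.exp_add, Real.exp_le_exp]
        linarith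

end Asymptotics

/-! ### Assembly of the tail bound and the theorem -/

/-- The norm of a random restriction of a matrix with small entries. -/
theorem randomPair_real_norm_restrict_le {n k m q k₀ : ℕ} {δ : ℝ} (hδ : 0 < δ) (hδ1 : δ ≤ 1)
    (hq : 0 < q) (hqn : q ≤ n) (hk : k ≤ n) (hm : m ≤ n) (hkm : (k : ℝ) + m ≤ δ * n)
    {A : Matrix (Fin n) (Fin n) ℂ} (hA1 : ‖A‖ ≤ 1)
    (hA : ∀ i j, ‖A i j‖ ≤ (n : ℝ) ^ (-(1 / 2 : ℝ))) :
    (randomPair n k m).real {p | 1 / 2 ≤ ‖restrict A p.2 p.1‖ ^ 2} ≤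
      (n + 1 : ℝ) ^ 2 * (2 ^ q * ((4 * q + 1) * ((4 * Real.exp 1) ^ (4 * q) *
        (n * δ ^ k₀ + (4 * Real.exp 4 * q ^ 2 / n) ^ q * (n / q : ℝ) ^ k₀)))) := by
  have hn : 0 < n := hq.trans_le hqn
  have hn' : (0 : ℝ) < n := by exact_mod_cast hn
  have hA' : ∀ i j, ‖A i j‖ ^ 2 ≤ (n : ℝ)⁻¹ := by
    intro i j
    have h := pow_le_pow_left₀ (norm_nonneg _) (hA i j) 2
    rw [← Real.rpow_natCast, ← Real.rpow_natCast, ← Real.rpow_mul hn'.le] at h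
    norm_num at h
    rwa [Real.rpow_neg_one] at h
  have h := randomPair_real_le hn hk hm {p | 1 / 2 ≤ ‖restrict A p.2 p.1‖ ^ 2}
    (fun S => 2 ^ q * traceMoment (cut A S) q)
    (fun S => mul_nonneg (by positivity) (traceMoment_nonneg _ _)) (by
      intro S hS
      have h1 : 1 / 2 ≤ ‖cut A S‖ ^ 2 := le_trans hS
        (pow_le_pow_left₀ (norm_nonneg _) (norm_restrict_le_norm_cut A S) 2)
      calc (1 : ℝ) = 2 ^ q * (1 / 2) ^ q := by rw [← mul_pow]; norm_num
        _ ≤ 2 ^ q * (‖cut A S‖ ^ 2) ^ q := by gcongr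
        _ ≤ _ := by gcongr; exact norm_pow_le_traceMoment _ _ hq.ne')
  refine h.trans (mul_le_mul_of_nonneg_left ?_ (by positivity))
  -- The densities `k/n` and `m/n` are written as `δ * p i`; `k + m ≤ δ n` ensures `p i ≤ 1`, so
  -- that the family `s * p i` is admissible for all `s` in `[0, 1]`.
  set p : Fin n ⊕ Fin n → ℝ := Sum.elim (fun _ => (k : ℝ) / (δ * n)) fun _ => (m : ℝ) / (δ * n)
    with hp
  have hx : (Sum.elim (fun _ => (k : ℝ) / n) fun _ => (m : ℝ) / n : Fin n ⊕ Fin n → ℝ) =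
      fun i => δ * p i := by
    ext (i | i) <;> simp [hp] <;> field_simp
  have hk0 : (0 : ℝ) ≤ k := Nat.cast_nonneg k
  have hm0 : (0 : ℝ) ≤ m := Nat.cast_nonneg m
  have hp0 : ∀ i, 0 ≤ p i := by
    rintro (i | i) <;> simp only [hp, Sum.elim_inl, Sum.elim_inr] <;> positivity
  have hp1 : ∀ i, p i ≤ 1 := by
    rintro (i | i) <;> simp only [hp, Sum.elim_inl, Sum.elim_inr] <;>
      rw [div_le_one (by positivity)] <;> linarith
  calc _ = 2 ^ q * ∑ S, bernoulliWeight (fun i => δ * p i) S * traceMoment (cut A S) q := by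
        rw [hx, Finset.mul_sum]
        exact Finset.sum_congr rfl fun S _ => by ring
    _ ≤ _ := mul_le_mul_of_nonneg_left
        (sum_bernoulliWeight_mul_traceMoment_le hA1 hA' hq hqn hp0 hp1 hδ.le hδ1 k₀) (by positivity)

theorem isProbabilityMeasure_randomPair {n k m : ℕ} (hk : k ≤ n) (hm : m ≤ n) :
    IsProbabilityMeasure (randomPair n k m) := by
  have h : ∀ j ≤ n, IsProbabilityMeasure (uniformOn {S : Finset (Fin n) | S.card = j}) := by
    intro j hj
    refine isProbabilityMeasure_uniformOn (Set.toFinite _) ?_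
    obtain ⟨S, _, hS⟩ := Finset.exists_subset_card_eq (s := (Finset.univ : Finset (Fin n))) (n := j)
      (by simpa using hj)
    exact ⟨S, hS⟩
  have := h k hk
  have := h m hm
  unfold randomPair
  infer_instance

end SpikesSines

open SpikesSines
theorem theorem2p8 :
    ∃ (C : ℝ) (c : ℝ → ℝ) (N : ℝ → ℕ), 0 < C ∧
      (∀ ε : ℝ, 0 < ε → Real.exp (-C / min ε 1) ≤ c ε) ∧
      ∀ ε : ℝ, 0 < ε → ∀ n : ℕ, N ε ≤ n → ∀ k m : ℕ, k ≤ n → m ≤ n →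
        (k : ℝ) + (m : ℝ) ≤ c ε * (n : ℝ) →
        -- the discrete Fourier transform
        (randomPair n k m).real {p | 1 / 2 ≤ ‖restrict (dft n) p.2 p.1‖ ^ 2}
            ≤ Real.exp (-(n : ℝ) ^ (1 / 2 - ε)) ∧
        -- strong linear independence of the random collection of spikes and sines
        1 - Real.exp (-(n : ℝ) ^ (1 / 2 - ε)) ≤
          (randomPair n k m).real {p | LinearIndependent ℂ (collection p.1 p.2) ∧
            gramCond (collection p.1 p.2) < 3 + 2 * Real.sqrt 2} ∧
        -- every matrix with norm at most one and uniformly bounded entries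
        ∀ A : Matrix (Fin n) (Fin n) ℂ, ‖A‖ ≤ 1 →
          (∀ i j, ‖A i j‖ ≤ (n : ℝ) ^ (-(1 / 2 : ℝ))) →
          (randomPair n k m).real {p | 1 / 2 ≤ ‖restrict A p.2 p.1‖ ^ 2}
            ≤ Real.exp (-(n : ℝ) ^ (1 / 2 - ε)) := by
  classical
  refine ⟨64, fun ε => Real.exp (-64 / min ε 1),
    fun ε => if h : 0 < ε then (exists_moment_order ε h).choose else 0, by norm_num,
    fun _ _ => le_rfl, ?_⟩
  intro ε hε n hn k m hk hm hkm
  simp only [dif_pos hε] at hn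
  obtain ⟨q, k₀, hq, hqn, hqε, hbound⟩ := (exists_moment_order ε hε).choose_spec n hn
  have main : ∀ A : Matrix (Fin n) (Fin n) ℂ, ‖A‖ ≤ 1 →
      (∀ i j, ‖A i j‖ ≤ (n : ℝ) ^ (-(1 / 2 : ℝ))) →
      (randomPair n k m).real {p | 1 / 2 ≤ ‖restrict A p.2 p.1‖ ^ 2}
        ≤ Real.exp (-(n : ℝ) ^ (1 / 2 - ε)) := by
    intro A hA1 hA
    have hδ1 : Real.exp (-64 / min ε 1) ≤ 1 := by
      rw [Real.exp_le_one_iff, neg_div, neg_nonpos]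
      have : 0 < min ε 1 := lt_min hε one_pos
      positivity
    exact (randomPair_real_norm_restrict_le (Real.exp_pos _) hδ1 hq hqn hk hm hkm hA1 hA).trans
      (hbound.trans (Real.exp_le_exp.2 (neg_le_neg hqε)))
  have hdft := main (dft n) (norm_dft_le n) fun i j => (norm_dft_apply n i j).le
  refine ⟨hdft, ?_, main⟩
  have := isProbabilityMeasure_randomPair hk hm
  calc _ ≤ 1 - (randomPair n k m).real {p | 1 / 2 ≤ ‖restrict (dft n) p.2 p.1‖ ^ 2} := by linarith
    _ = (randomPair n k m).real {p | 1 / 2 ≤ ‖restrict (dft n) p.2 p.1‖ ^ 2}ᶜ :=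
        (probReal_compl_eq_one_sub (Set.toFinite _).measurableSet).symm
    _ ≤ _ := measureReal_mono fun p hp =>
        strongly_linearIndependent_of_norm_lt (not_le.1 hp)
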